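/- Let $(M,d)$ be a complete metric space with Borel $\sigma$-algebra $\mathcal B(M)$. Let $\mathcal P(M)$ be the set of Borel probability measures $\mu$ on $M$ with $\mu(\operatorname{supp}\mu)=1$ (automatic if $M$ is separable), and define $\mathcal P(M\times M)$ likewise with respect to the Borel $\sigma$-algebra of $M\times M$. For $1\le p<\infty$ let $\mathcal P^p(M)$ be the set of $\mu\in\mathcal P(M)$ with $\int_M d(x,y)^p\,d\mu(y)<\infty$ for some $x\in M$, equipped with the $p$-Wasserstein distance $$d_p^W(\mu,\nu)=\Bigl[\inf_{\pi\in\Pi(\mu,\nu)}\int_{M\times M}d(x,y)^p\,d\pi(x,y)\Bigr]^{1/p},$$ where $\Pi(\mu,\nu)$ is the set of $\pi\in\mathcal P(M\times M)$ with marginals $\mu$ and $\nu$; let $\mathcal P^\infty(M)\subset\mathcal P^p(M)$ be the set of $\mu\in\mathcal P(M)$ with bounded support. Let $1\le p<\infty$ and let $\beta:\mathcal P^p(M)\to M$ be a $p$-contractive barycentric map, that is, $\beta(\delta_x)=x$ for all $x\in M$ and $d(\beta(\mu),\beta(\nu))\le d_p^W(\mu,\nu)$ for all $\mu,\nu\in\mathcal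 P^p(M)$. Let $X_1,X_2,\dots$ be i.i.d. $M$-valued random variables (Borel measurable maps) on a probability space $(\Omega,\mathcal A,\mathbf P)$ whose common distribution $\mu_0$ belongs to $\mathcal P^\infty(M)$. Then, for $\mathbf P$-almost every $\omega\in\Omega$, $$\beta\Bigl(\frac1n\sum_{i=1}^n\delta_{X_i(\omega)}\Bigr)\longrightarrow\beta(\mu_0)\qquad\text{in }(M,d)\text{ as }n\to\infty.$$ -/

import Mathlib

open MeasureTheory ProbabilityTheory Filter Topology
open scoped ENNReal

namespace Barycentric

/-- Probability measures that are concentrated on their support, i.e. `μ (supp μ) = 1`. On a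
non-separable metric space this is a restriction; it amounts to having separable support. -/
structure IsFullySupported {X : Type*} [TopologicalSpace X] {m : MeasurableSpace X}
    (μ : Measure X) : Prop where
  prob : IsProbabilityMeasure μ
  full : μ μ.support = 1

/-- The set of Borel probability measures with full support and finite `p`-th moment. -/
structure IsPth {M : Type*} [MetricSpace M] [MeasurableSpace M] (p : ℝ) (μ : Measure M) :
    Prop where
  fullySupported : IsFullySupported μ
  moment : ∃ x : M, ∫⁻ y, edist x y ^ p ∂μ < ∞

/-- The set of Borel probability measures with full and bounded support. -/
structure IsBdd {M : Type*} [MetricSpace M] [MeasurableSpace M] (μ : Measure M) : Prop where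
  fullySupported : IsFullySupported μ
  bounded : ∃ (x : M) (α : ℝ), μ.support ⊆ Metric.closedBall x α

/-- The space `𝒫ᵖ(M)`. -/
def Pp (p : ℝ) (M : Type*) [MetricSpace M] [MeasurableSpace M] : Type _ :=
  {μ : Measure M // IsPth p μ}

/-- Couplings of `μ` and `ν`. They live on the Borel σ-algebra of `M × M`, which for a
non-separable `M` may be larger than the product σ-algebra. -/
structure IsCoupling {M : Type*} [MetricSpace M] [MeasurableSpace M]
    (π : @Measure (M × M) (borel (M × M))) (μ ν : Measure M) : Prop where
  fullySupported : IsFullySupported π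
  fst : ∀ B : Set M, MeasurableSet B → π (B ×ˢ Set.univ) = μ B
  snd : ∀ B : Set M, MeasurableSet B → π (Set.univ ×ˢ B) = ν B

/-- The `p`-Wasserstein distance, with values in `[0, ∞]`. -/
noncomputable def wasserstein {M : Type*} [MetricSpace M] [MeasurableSpace M] (p : ℝ)
    (μ ν : Measure M) : ℝ≥0∞ :=
  (⨅ π : {π : @Measure (M × M) (borel (M × M)) // IsCoupling π μ ν},
    ∫⁻ z, edist z.1 z.2 ^ p ∂π.1) ^ (1 / p)

section Membership

variable {M : Type*} [MetricSpace M] [MeasurableSpace M] [BorelSpace M]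

lemma IsFullySupported.measure_compl_support {μ : Measure M} (h : IsFullySupported μ) :
    μ μ.supportᶜ = 0 := by
  have := h.prob
  exact (prob_compl_eq_zero_iff Measure.isClosed_support.measurableSet).2 h.full

lemma IsBdd.isPth {p : ℝ} (hp : 1 ≤ p) {μ : Measure M} (h : IsBdd μ) : IsPth p μ := by
  refine ⟨h.fullySupported, ?_⟩
  obtain ⟨x, α, hα⟩ := h.bounded
  have := h.fullySupported.prob
  refine ⟨x, ?_⟩
  have hae : ∀ᵐ y ∂μ, edist x y ^ p ≤ ENNReal.ofReal α ^ p := by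
    have h0 : ∀ᵐ y ∂μ, y ∈ μ.support := h.fullySupported.measure_compl_support
    filter_upwards [h0] with y hy
    refine ENNReal.rpow_le_rpow ?_ (by linarith)
    rw [edist_dist, dist_comm]
    exact ENNReal.ofReal_le_ofReal (hα hy)
  calc ∫⁻ y, edist x y ^ p ∂μ ≤ ∫⁻ _, ENNReal.ofReal α ^ p ∂μ := lintegral_mono_ae hae
    _ = ENNReal.ofReal α ^ p := by simp
    _ < ∞ := ENNReal.rpow_lt_top_of_nonneg (by linarith) ENNReal.ofReal_ne_top

/-- A probability measure carried by a finite set has full and bounded support. -/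
lemma isBdd_of_finite {μ : Measure M} [IsProbabilityMeasure μ] {s : Set M} (hs : s.Finite)
    (hμ : μ sᶜ = 0) : IsBdd μ := by
  have hsub : μ.support ⊆ s := Measure.support_subset_of_isClosed hs.isClosed hμ
  have hnull : μ μ.supportᶜ = 0 := by
    have h1 : μ (s \ μ.support) = 0 := by
      refine (measure_null_iff_singleton (hs.countable.mono Set.sdiff_subset)).2 ?_
      intro x hx
      obtain ⟨U, hU, hU0⟩ := Measure.notMem_support_iff_exists.1 hx.2
      exact measure_mono_null (Set.singleton_subset_iff.2 (mem_of_mem_nhds hU)) hU0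
    refine measure_mono_null (t := s \ μ.support ∪ sᶜ) ?_ (measure_union_null h1 hμ)
    intro x hx
    by_cases hxs : x ∈ s
    · exact Or.inl ⟨hxs, hx⟩
    · exact Or.inr hxs
  refine ⟨⟨inferInstance,
    (prob_compl_eq_zero_iff Measure.isClosed_support.measurableSet).1 hnull⟩, ?_⟩
  obtain ⟨x⟩ : Nonempty M := nonempty_of_isProbabilityMeasure μ
  obtain ⟨α, hα⟩ := hs.isBounded.subset_closedBall x
  exact ⟨x, α, hsub.trans hα⟩

lemma isBdd_dirac (x : M) : IsBdd (Measure.dirac x) :=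
  isBdd_of_finite (Set.finite_singleton x)
    (by rw [Measure.dirac_apply' _ (measurableSet_singleton x).compl]; simp)

/-- The point mass `δ_x` as an element of `𝒫ᵖ(M)`. -/
noncomputable def pointMass {p : ℝ} (hp : 1 ≤ p) (x : M) : Pp p M :=
  ⟨Measure.dirac x, (isBdd_dirac x).isPth hp⟩

/-- The uniform measure `n⁻¹ ∑_{i < n} δ_{x i}` on the first `n` terms of a sequence. -/
noncomputable def empiricalMeasure (n : ℕ) (x : ℕ → M) : Measure M :=
  (n : ℝ≥0∞)⁻¹ • ∑ i ∈ Finset.range n, Measure.dirac (x i)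

lemma isBdd_empiricalMeasure {n : ℕ} (hn : 0 < n) (x : ℕ → M) :
    IsBdd (empiricalMeasure n x) := by
  have : IsProbabilityMeasure (empiricalMeasure n x) := ⟨by
    simp only [empiricalMeasure, Measure.smul_apply, Measure.finsetSum_apply, measure_univ,
      Finset.sum_const, Finset.card_range, nsmul_eq_mul, mul_one, smul_eq_mul]
    exact ENNReal.inv_mul_cancel (by exact_mod_cast hn.ne') (ENNReal.natCast_ne_top n)⟩
  have hs : (x '' (Finset.range n : Set ℕ)).Finite := (Finset.finite_toSet _).image x
  refine isBdd_of_finite hs ?_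
  simp only [empiricalMeasure, Measure.smul_apply, Measure.finsetSum_apply, smul_eq_mul]
  rw [Finset.sum_eq_zero, mul_zero]
  intro i hi
  rw [Measure.dirac_apply' _ hs.measurableSet.compl]
  simp only [Set.indicator_apply_eq_zero, Set.mem_compl_iff]
  exact fun h => (h ⟨i, hi, rfl⟩).elim

/-- The empirical measure of `x 0, …, x (n - 1)` as an element of `𝒫ᵖ(M)`, for `n ≥ 1`. -/
noncomputable def empirical {p : ℝ} (hp : 1 ≤ p) {n : ℕ} (hn : 0 < n) (x : ℕ → M) : Pp p M :=
  ⟨empiricalMeasure n x, (isBdd_empiricalMeasure hn x).isPth hp⟩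

/-- `p`-contractive barycentric maps `β : 𝒫ᵖ(M) → M`. -/
structure IsContractiveBarycentric {p : ℝ} (hp : 1 ≤ p) (β : Pp p M → M) : Prop where
  pointMass : ∀ x : M, β (pointMass hp x) = x
  contractive : ∀ μ ν : Pp p M, edist (β μ) (β ν) ≤ wasserstein p μ.1 ν.1

end Membership

end Barycentric

/- By contractivity it suffices that the empirical measures converge to `μ₀` in `wasserstein p`.
Take a simple function `T` with `∫ d(x, T x)ᵖ dμ₀` small. By the strong law, the masses of the
fibres of `T` and the integrals of `d(x, T x)ᵖ` under the empirical measures converge to those under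
`μ₀`. Coupling the common part of the masses fibre by fibre gives `T z.1 = T z.2` outside a set of
vanishing measure, and Minkowski's inequality on the path from `z.1` to `z.2` through `T z.1` and
`T z.2` bounds the transport cost. When `M` is not separable, the coupling is carried to the Borel
σ-algebra of `M × M` by a.e. strong measurability of the identity of a fully supported measure. -/

namespace Barycentric

section Support

open TopologicalSpace

variable {X : Type*} [MeasurableSpace X]

lemma countable_of_isSeparated_of_subset_support [PseudoEMetricSpace X] [OpensMeasurableSpace X]
    {μ : Measure X} [SFinite μ] {ε : ℝ≥0∞} (hε : ε ≠ 0) {N : Set X} (hN : Metric.IsSeparated ε N)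
    (hNμ : N ⊆ μ.support) : N.Countable := by
  have hdisj : Pairwise (Function.onFun Disjoint fun x : N => Metric.eball (x : X) (ε / 2)) := by
    intro x y hxy
    refine Metric.eball_disjoint ?_
    rw [ENNReal.add_halves]
    exact (hN x.2 y.2 (Subtype.coe_ne_coe.2 hxy)).le
  have hpos : ∀ x : N, 0 < μ (Metric.eball (x : X) (ε / 2)) := fun x =>
    (Measure.mem_support_iff_forall _).1 (hNμ x.2) _
      (Metric.eball_mem_nhds _ (ENNReal.half_pos hε))
  have hcount := Measure.countable_meas_pos_of_disjoint_iUnion (μ := μ)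
    (fun x : N => (Metric.isOpen_eball (x := (x : X))).measurableSet) hdisj
  have hNcount := hcount.mono fun x (_ : x ∈ Set.univ) => hpos x
  exact Set.countable_coe_iff.1 (Set.countable_univ_iff.1 hNcount)

lemma isSeparable_support [PseudoEMetricSpace X] [OpensMeasurableSpace X] (μ : Measure X)
    [SFinite μ] : IsSeparable μ.support := by
  suffices ∀ ε > 0, ∃ N : Set X, N.Countable ∧ μ.support ⊆ ⋃ x ∈ N, Metric.closedEBall x ε by
    obtain ⟨t, -, htc, ht⟩ := EMetric.subset_countable_closure_of_almost_dense_set _ this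
    exact ⟨t, htc, ht⟩
  intro ε hε
  obtain ⟨δ, hδ, hδε⟩ := ENNReal.lt_iff_exists_nnreal_btwn.1 hε
  obtain ⟨N, -, hN⟩ := zorn_subset_nonempty
    {N : Set X | N ⊆ μ.support ∧ Metric.IsSeparated (δ : ℝ≥0∞) N}
    (fun c hc hchain _ => ⟨⋃₀ c, ⟨Set.sUnion_subset fun s hs => (hc hs).1,
      (Set.pairwise_sUnion hchain.directedOn).2 fun s hs => (hc hs).2⟩,
      fun s hs => Set.subset_sUnion_of_mem hs⟩)
    ∅ ⟨Set.empty_subset _, Metric.IsSeparated.empty⟩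
  have hcover := Metric.isCover_iff_subset_iUnion_closedEBall.1
    (Metric.IsCover.of_maximal_isSeparated hN)
  exact ⟨N, countable_of_isSeparated_of_subset_support hδ.ne' hN.prop.2 hN.prop.1,
    hcover.trans (Set.iUnion₂_mono fun _ _ => Metric.closedEBall_subset_closedEBall hδε.le)⟩

lemma support_mem_ae_of_isSeparable [TopologicalSpace X] [PseudoMetrizableSpace X]
    {μ : Measure X} {S : Set X} (hS : IsSeparable S) (hμS : ∀ᵐ x ∂μ, x ∈ S) :
    μ.support ∈ ae μ := by
  have := (hS.mono (Set.inter_subset_left (t := μ.supportᶜ))).secondCountableTopology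
  have hlindelof : IsLindelof (S ∩ μ.supportᶜ) :=
    isLindelof_iff_isLindelof_univ.2 isLindelof_univ
  have hcompl : (S ∩ μ.supportᶜ)ᶜ ∈ ae μ := by
    refine hlindelof.compl_mem_sets_of_nhdsWithin fun x hx => ?_
    obtain ⟨U, hU, hU0⟩ := Measure.notMem_support_iff_exists.1 hx.2
    exact ⟨U, mem_nhdsWithin_of_mem_nhds hU, compl_mem_ae_iff.2 hU0⟩
  filter_upwards [hμS, hcompl] with x hxS hx
  exact not_not.1 fun hxμ => hx ⟨hxS, hxμ⟩

lemma isFullySupported_map [TopologicalSpace X] [PseudoMetrizableSpace X] [BorelSpace X]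
    {α : Type*} [MeasurableSpace α] {ρ : Measure α} [IsProbabilityMeasure ρ] {f : α → X}
    (hf : AEStronglyMeasurable f ρ) : IsFullySupported (ρ.map f) := by
  obtain ⟨S, hS, hfS⟩ := (aestronglyMeasurable_iff_aemeasurable_separable.1 hf).2
  have hprob := Measure.isProbabilityMeasure_map hf.aemeasurable
  have hmem : ∀ᵐ x ∂ρ.map f, x ∈ closure S :=
    (ae_map_iff hf.aemeasurable isClosed_closure.measurableSet).2
      (hfS.mono fun _ ha => subset_closure ha)
  exact ⟨hprob, (prob_compl_eq_zero_iff Measure.isClosed_support.measurableSet).1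
    (support_mem_ae_of_isSeparable hS.closure hmem)⟩

lemma IsFullySupported.aestronglyMeasurable_id {M : Type*} [MetricSpace M] [MeasurableSpace M]
    [BorelSpace M] {μ : Measure M} (hμ : IsFullySupported μ) : AEStronglyMeasurable id μ := by
  have := hμ.prob
  exact aestronglyMeasurable_iff_aemeasurable_separable.2
    ⟨aemeasurable_id, _, isSeparable_support μ, hμ.measure_compl_support⟩

end Support

section Coupling

variable {α β γ : Type*} [MeasurableSpace α] [MeasurableSpace β]

lemma exists_measure_fst_eq_snd_eq (μ : Measure α) [IsFiniteMeasure μ] (ν : Measure β)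
    (h : μ Set.univ = ν Set.univ) : ∃ π : Measure (α × β), π.fst = μ ∧ π.snd = ν := by
  have : IsFiniteMeasure ν := ⟨h ▸ measure_lt_top μ _⟩
  rcases eq_or_ne (μ Set.univ) 0 with h0 | h0
  · have hμ : μ = 0 := Measure.measure_univ_eq_zero.1 h0
    have hν : ν = 0 := Measure.measure_univ_eq_zero.1 (h.symm.trans h0)
    exact ⟨0, by rw [hμ, Measure.fst_zero], by rw [hν, Measure.snd_zero]⟩
  · have hcancel := ENNReal.inv_mul_cancel h0 (measure_ne_top μ _)
    refine ⟨(μ Set.univ)⁻¹ • μ.prod ν, ?_, ?_⟩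
    · rw [Measure.fst, Measure.map_smul, Measure.map_fst_prod, ← h, smul_smul, hcancel, one_smul]
    · rw [Measure.snd, Measure.map_smul, Measure.map_snd_prod, smul_smul, hcancel, one_smul]

lemma exists_le_restrict_measure_univ_eq (μ : Measure α) [IsFiniteMeasure μ] (A : Set α)
    {c : ℝ≥0∞} (hc : c ≤ μ A) : ∃ μ' ≤ μ.restrict A, μ' Set.univ = c := by
  refine ⟨(c / μ A) • μ.restrict A, ?_, ?_⟩
  · calc (c / μ A) • μ.restrict A ≤ (1 : ℝ≥0∞) • μ.restrict A := by
          gcongr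
          exact ENNReal.div_le_of_le_mul (by rwa [one_mul])
      _ = μ.restrict A := one_smul _ _
  · simp only [Measure.smul_apply, Measure.restrict_apply_univ, smul_eq_mul]
    exact ENNReal.div_mul_cancel' (fun h => by simpa [h] using hc)
      fun h => absurd h (measure_ne_top μ A)

lemma exists_coupling_sum_add_measure_ne_le {s : Finset γ} {μ' : γ → Measure α} {μr : Measure α}
    {ν' : γ → Measure β} {νr : Measure β} [∀ i, IsFiniteMeasure (μ' i)] [IsFiniteMeasure μr]
    {f : α → γ} {g : β → γ} (hμf : ∀ i, ∀ᵐ a ∂μ' i, f a = i) (hνg : ∀ i, ∀ᵐ b ∂ν' i, g b = i)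
    (h' : ∀ i, μ' i Set.univ = ν' i Set.univ) (hr : μr Set.univ = νr Set.univ) :
    ∃ π : Measure (α × β), π.fst = ∑ i ∈ s, μ' i + μr ∧ π.snd = ∑ i ∈ s, ν' i + νr ∧
      π {z | f z.1 ≠ g z.2} ≤ μr Set.univ := by
  choose π hπfst hπsnd using fun i => exists_measure_fst_eq_snd_eq (μ' i) (ν' i) (h' i)
  obtain ⟨πr, hπrfst, hπrsnd⟩ := exists_measure_fst_eq_snd_eq μr νr hr
  have hne : ∀ i, π i {z | f z.1 ≠ g z.2} = 0 := fun i => by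
    have hf_eq : ∀ᵐ z ∂π i, f z.1 = i :=
      ae_of_ae_map measurable_fst.aemeasurable (hπfst i ▸ hμf i)
    have hg_eq : ∀ᵐ z ∂π i, g z.2 = i :=
      ae_of_ae_map measurable_snd.aemeasurable (hπsnd i ▸ hνg i)
    have heq : ∀ᵐ z ∂π i, f z.1 = g z.2 := by
      filter_upwards [hf_eq, hg_eq] with z h₁ h₂ using h₁.trans h₂.symm
    exact ae_iff.1 heq
  refine ⟨∑ i ∈ s, π i + πr, ?_, ?_, ?_⟩
  · simp_rw [← hπfst, ← hπrfst, Measure.fst]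
    rw [Measure.map_add _ _ measurable_fst, Measure.map_finset_sum measurable_fst.aemeasurable]
  · simp_rw [← hπsnd, ← hπrsnd, Measure.snd]
    rw [Measure.map_add _ _ measurable_snd, Measure.map_finset_sum measurable_snd.aemeasurable]
  · calc (∑ i ∈ s, π i + πr) {z | f z.1 ≠ g z.2} = πr {z | f z.1 ≠ g z.2} := by simp [hne]
      _ ≤ πr Set.univ := measure_mono (Set.subset_univ _)
      _ = μr Set.univ := by rw [← hπrfst, Measure.fst_univ]

variable [MeasurableSpace γ] [MeasurableSingletonClass γ]

lemma sum_restrict_preimage_singleton_le (μ : Measure α) {f : α → γ} (hf : Measurable f)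
    (s : Finset γ) : ∑ i ∈ s, μ.restrict (f ⁻¹' {i}) ≤ μ := by
  have hdisj : (s : Set γ).PairwiseDisjoint fun i => f ⁻¹' {i} := fun i _ j _ hij =>
    Disjoint.preimage f (Set.disjoint_singleton.2 hij)
  rw [← Measure.sum_coe_finset,
    ← Measure.restrict_biUnion_finset hdisj fun i => hf (measurableSet_singleton i)]
  exact Measure.restrict_le_self

lemma exists_sum_add_eq_of_le_preimage_singleton (μ : Measure α) [IsFiniteMeasure μ] {f : α → γ}
    (hf : Measurable f) (s : Finset γ) {c : γ → ℝ≥0∞} (hc : ∀ i, c i ≤ μ (f ⁻¹' {i})) :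
    ∃ (μ' : γ → Measure α) (μr : Measure α), ∑ i ∈ s, μ' i + μr = μ ∧
      (∀ i, μ' i Set.univ = c i) ∧ ∀ i, ∀ᵐ a ∂μ' i, f a = i := by
  choose μ' hle hmass using fun i => exists_le_restrict_measure_univ_eq μ _ (hc i)
  have hsum : ∑ i ∈ s, μ' i ≤ μ :=
    (Finset.sum_le_sum fun i _ => hle i).trans (sum_restrict_preimage_singleton_le μ hf s)
  have := isFiniteMeasure_of_le μ hsum
  refine ⟨μ', μ - ∑ i ∈ s, μ' i, ?_, hmass, fun i => ?_⟩
  · rw [add_comm, Measure.sub_add_cancel_of_le hsum]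
  · exact (Measure.absolutelyContinuous_of_le (hle i)).ae_le
      (ae_restrict_mem (hf (measurableSet_singleton i)))

lemma exists_coupling_measure_ne_le (μ : Measure α) [IsFiniteMeasure μ] (ν : Measure β)
    (h : μ Set.univ = ν Set.univ) {f : α → γ} (hf : Measurable f) {g : β → γ}
    (hg : Measurable g) (s : Finset γ) :
    ∃ π : Measure (α × β), π.fst = μ ∧ π.snd = ν ∧ π {z | f z.1 ≠ g z.2} ≤
      μ Set.univ - ∑ i ∈ s, min (μ (f ⁻¹' {i})) (ν (g ⁻¹' {i})) := by
  have : IsFiniteMeasure ν := ⟨h ▸ measure_lt_top μ _⟩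
  let c : γ → ℝ≥0∞ := fun i => min (μ (f ⁻¹' {i})) (ν (g ⁻¹' {i}))
  obtain ⟨μ', μr, hμ, hμc, hμf⟩ :=
    exists_sum_add_eq_of_le_preimage_singleton μ hf s (c := c) fun _ => min_le_left _ _
  obtain ⟨ν', νr, hν, hνc, hνg⟩ :=
    exists_sum_add_eq_of_le_preimage_singleton ν hg s (c := c) fun _ => min_le_right _ _
  have hμr : ∑ i ∈ s, c i + μr Set.univ = μ Set.univ := by simp [← hμ, hμc]
  have hνr : ∑ i ∈ s, c i + νr Set.univ = ν Set.univ := by simp [← hν, hνc]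
  have hc : ∑ i ∈ s, c i ≠ ∞ := ne_top_of_le_ne_top (measure_ne_top μ _) (hμr ▸ le_self_add)
  have hr : μr Set.univ = νr Set.univ := (ENNReal.add_right_inj hc).1 (by rw [hμr, hνr, h])
  have : IsFiniteMeasure μr := isFiniteMeasure_of_le μ (hμ ▸ Measure.le_add_left le_rfl)
  have : ∀ i, IsFiniteMeasure (μ' i) := fun i =>
    ⟨(hμc i).trans_lt ((min_le_left _ _).trans_lt (measure_lt_top μ _))⟩
  obtain ⟨π, hfst, hsnd, hne⟩ := exists_coupling_sum_add_measure_ne_le (s := s) hμf hνg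
    (fun i => (hμc i).trans (hνc i).symm) hr
  exact ⟨π, hfst.trans hμ, hsnd.trans hν, hne.trans (ENNReal.le_sub_of_add_le_left hc hμr.le)⟩

end Coupling

section Wasserstein

lemma tendsto_one_sub_sum_min_measure_preimage {ι α β : Type*} [MeasurableSpace α]
    {l : Filter ι} {μ : ι → Measure α} {ν : Measure α} [IsProbabilityMeasure ν]
    {T : SimpleFunc α β}
    (h : ∀ y ∈ T.range, Tendsto (fun i => μ i (T ⁻¹' {y})) l (𝓝 (ν (T ⁻¹' {y})))) :
    Tendsto (fun i => 1 - ∑ y ∈ T.range, min (μ i (T ⁻¹' {y})) (ν (T ⁻¹' {y}))) l (𝓝 0) := by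
  have hmin : Tendsto (fun i => ∑ y ∈ T.range, min (μ i (T ⁻¹' {y})) (ν (T ⁻¹' {y}))) l
      (𝓝 (∑ y ∈ T.range, ν (T ⁻¹' {y}))) :=
    tendsto_finsetSum _ fun y hy => by
      simpa using (h y hy).min (tendsto_const_nhds (x := ν (T ⁻¹' {y})))
  rw [T.sum_range_measure_preimage_singleton, measure_univ] at hmin
  simpa using ENNReal.Tendsto.sub tendsto_const_nhds hmin (Or.inl ENNReal.one_ne_top)

lemma lintegral_edist_comp_rpow_le {M α : Type*} [PseudoEMetricSpace M] [MeasurableSpace α]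
    (ρ : Measure α) {p : ℝ} (hp : 0 < p) (T : M → M) (f g : α → M) :
    ∫⁻ a, edist (T (f a)) (T (g a)) ^ p ∂ρ ≤
      ρ {a | T (f a) ≠ T (g a)} * Metric.ediam (Set.range T) ^ p := by
  rw [mul_comm]
  refine le_trans (lintegral_mono fun a => ?_) (lintegral_indicator_const_le _ _)
  by_cases h : T (f a) = T (g a)
  · simp [h, hp]
  · rw [Set.indicator_of_mem (by exact h)]
    gcongr
    exact Metric.edist_le_ediam_of_mem (Set.mem_range_self _) (Set.mem_range_self _)

variable {M : Type*} [MetricSpace M] [MeasurableSpace M] [BorelSpace M] {p : ℝ}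

lemma wasserstein_map_map_le {α : Type*} [MeasurableSpace α] {ρ : Measure α}
    [IsProbabilityMeasure ρ] (hp : 0 ≤ p) {f g : α → M} (hf : AEStronglyMeasurable f ρ)
    (hg : AEStronglyMeasurable g ρ) :
    wasserstein p (ρ.map f) (ρ.map g) ≤ (∫⁻ a, edist (f a) (g a) ^ p ∂ρ) ^ (1 / p) := by
  let _ : MeasurableSpace (M × M) := borel (M × M)
  have _ : BorelSpace (M × M) := ⟨rfl⟩
  have hfg : AEStronglyMeasurable (fun a => (f a, g a)) ρ := hf.prodMk hg
  have hmeas := hfg.aemeasurable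
  have hcoupling : IsCoupling (ρ.map fun a => (f a, g a)) (ρ.map f) (ρ.map g) := by
    refine ⟨isFullySupported_map hfg, fun B hB => ?_, fun B hB => ?_⟩
    · rw [Set.prod_univ, Measure.map_apply_of_aemeasurable hmeas (continuous_fst.measurable hB),
        Measure.map_apply_of_aemeasurable hf.aemeasurable hB]
      rfl
    · rw [Set.univ_prod, Measure.map_apply_of_aemeasurable hmeas (continuous_snd.measurable hB),
        Measure.map_apply_of_aemeasurable hg.aemeasurable hB]
      rfl
  have hcost : Measurable fun z : M × M => edist z.1 z.2 ^ p :=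
    continuous_edist.measurable.pow_const p
  refine ENNReal.rpow_le_rpow (iInf_le_of_le ⟨_, hcoupling⟩ ?_) (by positivity)
  rw [lintegral_map' hcost.aemeasurable hmeas]

lemma measurable_edist_simpleFunc_rpow (T : SimpleFunc M M) (p : ℝ) :
    Measurable fun x => edist x (T x) ^ p :=
  T.measurable_bind (fun y x => edist x y ^ p) fun _ =>
    (continuous_id.edist continuous_const).measurable.pow_const p

lemma wasserstein_le_of_simpleFunc {μ ν : Measure M} (hμ : IsFullySupported μ)
    (hν : IsFullySupported ν) (hp : 1 ≤ p) (T : SimpleFunc M M) :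
    wasserstein p μ ν ≤ (∫⁻ x, edist x (T x) ^ p ∂μ) ^ (1 / p) +
      ((1 - ∑ y ∈ T.range, min (μ (T ⁻¹' {y})) (ν (T ⁻¹' {y}))) *
        Metric.ediam (Set.range T) ^ p) ^ (1 / p) +
      (∫⁻ x, edist x (T x) ^ p ∂ν) ^ (1 / p) := by
  have hμprob := hμ.prob
  have hνprob := hν.prob
  have hp0 : 0 < p := zero_lt_one.trans_le hp
  obtain ⟨π, rfl, rfl, hne⟩ := exists_coupling_measure_ne_le μ ν
    (by rw [measure_univ, measure_univ]) T.measurable T.measurable T.range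
  have hπ : IsProbabilityMeasure π := ⟨by rw [← Measure.fst_univ, measure_univ]⟩
  have hfst : AEStronglyMeasurable Prod.fst π :=
    hμ.aestronglyMeasurable_id.comp_measurable measurable_fst
  have hsnd : AEStronglyMeasurable Prod.snd π :=
    hν.aestronglyMeasurable_id.comp_measurable measurable_snd
  have hTfst : AEStronglyMeasurable (fun z => T z.1) π :=
    T.stronglyMeasurable.aestronglyMeasurable.comp_measurable measurable_fst
  have hTsnd : AEStronglyMeasurable (fun z => T z.2) π :=
    T.stronglyMeasurable.aestronglyMeasurable.comp_measurable measurable_snd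
  have hcost := measurable_edist_simpleFunc_rpow T p
  rw [measure_univ] at hne
  calc wasserstein p π.fst π.snd
      ≤ (∫⁻ z, edist z.1 z.2 ^ p ∂π) ^ (1 / p) := wasserstein_map_map_le hp0.le hfst hsnd
    _ ≤ (∫⁻ z, (edist z.1 (T z.1) + edist (T z.1) (T z.2) + edist z.2 (T z.2)) ^ p ∂π) ^
          (1 / p) := by
        gcongr with z
        rw [edist_comm z.2]
        exact edist_triangle4 _ _ _ _
    _ ≤ (∫⁻ z, edist z.1 (T z.1) ^ p ∂π) ^ (1 / p) +
          (∫⁻ z, edist (T z.1) (T z.2) ^ p ∂π) ^ (1 / p) +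
          (∫⁻ z, edist z.2 (T z.2) ^ p ∂π) ^ (1 / p) :=
        (ENNReal.lintegral_Lp_add_le ((hfst.edist hTfst).add (hTfst.edist hTsnd))
          (hsnd.edist hTsnd) hp).trans (add_le_add_left
            (ENNReal.lintegral_Lp_add_le (hfst.edist hTfst) (hTfst.edist hTsnd) hp) _)
    _ ≤ _ := by
        rw [Measure.fst, Measure.snd, lintegral_map hcost measurable_fst,
          lintegral_map hcost measurable_snd]
        gcongr
        exact (lintegral_edist_comp_rpow_le π hp0 T _ _).trans (by gcongr; exact hne)

lemma IsPth.exists_tendsto_lintegral_edist_simpleFunc (hp : 0 < p) {μ : Measure M}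
    (hμ : IsPth p μ) :
    ∃ T : ℕ → SimpleFunc M M, (∀ m, ∫⁻ x, edist x (T m x) ^ p ∂μ ≠ ∞) ∧
      Tendsto (fun m => ∫⁻ x, edist x (T m x) ^ p ∂μ) atTop (𝓝 0) := by
  have := hμ.fullySupported.prob
  obtain ⟨x₀, hx₀⟩ := hμ.moment
  have hsep : TopologicalSpace.IsSeparable (insert x₀ μ.support) :=
    (Set.countable_singleton x₀).isSeparable.union (isSeparable_support μ)
  have := hsep.separableSpace
  have hmem : x₀ ∈ insert x₀ μ.support := Set.mem_insert _ _
  let T := SimpleFunc.approxOn (fun x : M => x) measurable_id _ x₀ hmem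
  have hbound : ∀ m x, edist x (T m x) ^ p ≤ edist x₀ x ^ p := fun m x => by
    rw [edist_comm x]
    gcongr
    exact SimpleFunc.edist_approxOn_le measurable_id hmem x m
  have hlim : ∀ᵐ x ∂μ, Tendsto (fun m => edist x (T m x) ^ p) atTop (𝓝 0) := by
    have hsupp : ∀ᵐ x ∂μ, x ∈ μ.support := hμ.fullySupported.measure_compl_support
    filter_upwards [hsupp] with x hx
    have hT : Tendsto (fun m => T m x) atTop (𝓝 x) :=
      SimpleFunc.tendsto_approxOn measurable_id hmem (subset_closure (Set.mem_insert_of_mem _ hx))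
    simpa [hp] using ((tendsto_const_nhds (x := x)).edist hT).ennrpow_const p
  refine ⟨T, fun m => ((lintegral_mono (hbound m)).trans_lt hx₀).ne, ?_⟩
  simpa only [lintegral_zero] using tendsto_lintegral_of_dominated_convergence _
    (fun m => measurable_edist_simpleFunc_rpow (T m) p) (fun m => ae_of_all μ (hbound m))
    hx₀.ne hlim

lemma tendsto_wasserstein_of_simpleFunc {ι : Type*} {l : Filter ι} (hp : 1 ≤ p)
    {μ : ι → Measure M} {ν : Measure M} (hμ : ∀ i, IsFullySupported (μ i))
    (hν : IsFullySupported ν) {T : ℕ → SimpleFunc M M}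
    (hT : Tendsto (fun m => ∫⁻ x, edist x (T m x) ^ p ∂ν) atTop (𝓝 0))
    (hcost : ∀ m, Tendsto (fun i => ∫⁻ x, edist x (T m x) ^ p ∂μ i) l
      (𝓝 (∫⁻ x, edist x (T m x) ^ p ∂ν)))
    (hmass : ∀ m, ∀ y ∈ (T m).range,
      Tendsto (fun i => μ i (T m ⁻¹' {y})) l (𝓝 (ν (T m ⁻¹' {y})))) :
    Tendsto (fun i => wasserstein p (μ i) ν) l (𝓝 0) := by
  have := hν.prob
  have hp0 : 0 < p := zero_lt_one.trans_le hp
  let δ : ℕ → ℝ≥0∞ := fun m => (∫⁻ x, edist x (T m x) ^ p ∂ν) ^ (1 / p)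
  have hδ : Tendsto (fun m => δ m + δ m) atTop (𝓝 0) := by
    have h := hT.ennrpow_const (1 / p)
    rw [ENNReal.zero_rpow_of_pos (one_div_pos.2 hp0)] at h
    simpa only [add_zero] using h.add h
  have hbound : ∀ m, Tendsto (fun i => (∫⁻ x, edist x (T m x) ^ p ∂μ i) ^ (1 / p) +
      ((1 - ∑ y ∈ (T m).range, min (μ i (T m ⁻¹' {y})) (ν (T m ⁻¹' {y}))) *
        Metric.ediam (Set.range (T m)) ^ p) ^ (1 / p) + δ m) l (𝓝 (δ m + δ m)) := fun m => by
    have hdiam : Metric.ediam (Set.range (T m)) ^ p ≠ ∞ :=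
      ENNReal.rpow_ne_top_of_nonneg hp0.le
        (Metric.isBounded_iff_ediam_ne_top.1 (T m).finite_range.isBounded)
    have hdefect := (ENNReal.Tendsto.mul_const
      (tendsto_one_sub_sum_min_measure_preimage (hmass m)) (Or.inr hdiam)).ennrpow_const (1 / p)
    rw [zero_mul, ENNReal.zero_rpow_of_pos (one_div_pos.2 hp0)] at hdefect
    simpa only [add_zero] using (((hcost m).ennrpow_const (1 / p)).add hdefect).add_const (δ m)
  refine ENNReal.tendsto_nhds_zero.2 fun ε hε => ?_
  obtain ⟨m, hm⟩ := (hδ.eventually_lt_const hε).exists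
  filter_upwards [(hbound m).eventually_lt_const hm] with i hi
  exact (wasserstein_le_of_simpleFunc (hμ i) hν hp (T m)).trans hi.le

end Wasserstein

section Empirical

variable {M : Type*} [MetricSpace M] [MeasurableSpace M] [BorelSpace M]
  {Ω : Type*} [MeasurableSpace Ω] {P : Measure Ω} {μ₀ : Measure M} {X : ℕ → Ω → M}

lemma lintegral_empiricalMeasure (n : ℕ) (x : ℕ → M) (φ : M → ℝ≥0∞) :
    ∫⁻ y, φ y ∂empiricalMeasure n x = (∑ i ∈ Finset.range n, φ (x i)) / n := by
  simp [empiricalMeasure, ENNReal.div_eq_inv_mul]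

lemma ae_tendsto_lintegral_empiricalMeasure (hindep : Pairwise fun i j => X i ⟂ᵢ[P] X j)
    (hlaw : ∀ i, HasLaw (X i) μ₀ P) {φ : M → ℝ≥0∞} (hφ : Measurable φ)
    (hint : ∫⁻ y, φ y ∂μ₀ ≠ ∞) :
    ∀ᵐ ω ∂P, Tendsto (fun n => ∫⁻ y, φ y ∂empiricalMeasure n fun i => X i ω) atTop
      (𝓝 (∫⁻ y, φ y ∂μ₀)) := by
  have hmeas : ∀ i, AEMeasurable (fun ω => φ (X i ω)) P := fun i =>
    hφ.comp_aemeasurable (hlaw i).aemeasurable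
  have hlint : ∀ i, ∫⁻ ω, φ (X i ω) ∂P = ∫⁻ y, φ y ∂μ₀ := fun i =>
    (hlaw i).lintegral_comp hφ.aemeasurable
  have hfin : ∀ i, ∀ᵐ ω ∂P, φ (X i ω) < ∞ := fun i =>
    ae_lt_top' (hmeas i) (by rwa [hlint])
  have hslln := strong_law_ae_real (fun i ω => (φ (X i ω)).toReal)
    (integrable_toReal_of_lintegral_ne_top (hmeas 0) (by rwa [hlint]))
    (fun i j hij => (hindep hij).comp hφ.ennreal_toReal hφ.ennreal_toReal)
    (fun i => ((hlaw i).identDistrib (hlaw 0)).comp hφ.ennreal_toReal)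
  rw [integral_toReal (hmeas 0) (hfin 0), hlint] at hslln
  filter_upwards [hslln, ae_all_iff.2 hfin] with ω hω hωfin
  rw [← ENNReal.ofReal_toReal hint]
  refine (ENNReal.tendsto_ofReal hω).congr' ?_
  filter_upwards [eventually_gt_atTop 0] with n hn
  rw [lintegral_empiricalMeasure, ENNReal.ofReal_div_of_pos (by exact_mod_cast hn),
    ← ENNReal.toReal_sum fun i _ => (hωfin i).ne, ENNReal.ofReal_natCast,
    ENNReal.ofReal_toReal (ENNReal.sum_ne_top.2 fun i _ => (hωfin i).ne)]

theorem ae_tendsto_wasserstein_empiricalMeasure {p : ℝ} (hp : 1 ≤ p) (hμ₀ : IsPth p μ₀)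
    (hindep : Pairwise fun i j => X i ⟂ᵢ[P] X j) (hlaw : ∀ i, HasLaw (X i) μ₀ P) :
    ∀ᵐ ω ∂P, Tendsto (fun n => wasserstein p (empiricalMeasure (n + 1) fun i => X i ω) μ₀) atTop
      (𝓝 0) := by
  have := hμ₀.fullySupported.prob
  obtain ⟨T, hTfin, hT⟩ :=
    hμ₀.exists_tendsto_lintegral_edist_simpleFunc (zero_lt_one.trans_le hp)
  have hcost : ∀ᵐ ω ∂P, ∀ m, Tendsto
      (fun n => ∫⁻ x, edist x (T m x) ^ p ∂empiricalMeasure n fun i => X i ω) atTop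
      (𝓝 (∫⁻ x, edist x (T m x) ^ p ∂μ₀)) :=
    ae_all_iff.2 fun m => ae_tendsto_lintegral_empiricalMeasure hindep hlaw
      (measurable_edist_simpleFunc_rpow (T m) p) (hTfin m)
  have hmass : ∀ᵐ ω ∂P, ∀ m, ∀ y ∈ (T m).range, Tendsto
      (fun n => empiricalMeasure n (fun i => X i ω) (T m ⁻¹' {y})) atTop
      (𝓝 (μ₀ (T m ⁻¹' {y}))) := by
    refine ae_all_iff.2 fun m => (ae_ball_iff (T m).range.countable_toSet).2 fun y _ => ?_
    have hfiber : MeasurableSet (T m ⁻¹' {y}) := (T m).measurableSet_fiber y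
    simpa only [lintegral_indicator_one hfiber] using
      ae_tendsto_lintegral_empiricalMeasure hindep hlaw (measurable_one.indicator hfiber)
        (by simp [lintegral_indicator_one hfiber])
  filter_upwards [hcost, hmass] with ω hωcost hωmass
  exact tendsto_wasserstein_of_simpleFunc hp
    (fun n => (isBdd_empiricalMeasure n.succ_pos _).fullySupported) hμ₀.fullySupported hT
    (fun m => (hωcost m).comp (tendsto_add_atTop_nat 1))
    fun m y hy => (hωmass m y hy).comp (tendsto_add_atTop_nat 1)

end Empirical

end Barycentric

theorem corollary6p3_general {M : Type*} [MetricSpace M] [MeasurableSpace M] [BorelSpace M]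
    {Ω : Type*} [MeasurableSpace Ω] {P : Measure Ω} {p : ℝ} (hp : 1 ≤ p)
    {E : Type*} [PseudoEMetricSpace E] {β : Barycentric.Pp p M → E}
    (hβ : ∀ μ ν : Barycentric.Pp p M, edist (β μ) (β ν) ≤ Barycentric.wasserstein p μ.1 ν.1)
    {μ₀ : Measure M} (hμ₀ : Barycentric.IsPth p μ₀) {X : ℕ → Ω → M}
    (hindep : Pairwise fun i j => X i ⟂ᵢ[P] X j) (hlaw : ∀ i, HasLaw (X i) μ₀ P) :
    ∀ᵐ ω ∂P, Tendsto (fun n : ℕ => β (Barycentric.empirical hp n.succ_pos fun i => X i ω)) atTop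
      (𝓝 (β ⟨μ₀, hμ₀⟩)) := by
  filter_upwards [Barycentric.ae_tendsto_wasserstein_empiricalMeasure hp hμ₀ hindep hlaw]
    with ω hω
  exact tendsto_iff_edist_tendsto_0.2
    (tendsto_of_tendsto_of_tendsto_of_le_of_le tendsto_const_nhds hω (fun _ => zero_le)
      fun _ => hβ _ _)

theorem corollary6p3 {M : Type*} [MetricSpace M] [CompleteSpace M]
    [MeasurableSpace M] [BorelSpace M]
    {Ω : Type*} [MeasurableSpace Ω] (P : Measure Ω) [IsProbabilityMeasure P]
    (p : ℝ) (hp : 1 ≤ p)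
    (β : Barycentric.Pp p M → M) (hβ : Barycentric.IsContractiveBarycentric hp β)
    (μ₀ : Measure M) (hμ₀ : Barycentric.IsBdd μ₀)
    (X : ℕ → Ω → M) (hX : ∀ i, Measurable (X i))
    (hindep : iIndepFun X P) (hlaw : ∀ i, P.map (X i) = μ₀) :
    ∀ᵐ ω ∂P, Tendsto
      (fun n : ℕ => β (Barycentric.empirical hp n.succ_pos (fun i => X i ω)))
      atTop (𝓝 (β ⟨μ₀, hμ₀.isPth hp⟩)) :=
  corollary6p3_general hp hβ.contractive (hμ₀.isPth hp)
    (fun _ _ => hindep.indepFun) fun i => ⟨(hX i).aemeasurable, hlaw i⟩
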